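/- Let $I_\nu(z)=(z/2)^\nu\sum_{n\ge 0}\frac{(z^2/4)^n}{n!\,\Gamma(\nu+n+1)}$ be the modified Bessel function of the first kind (principal branch). Let $l\ge 1$ be an integer and let $\alpha\ge 0$ be real. For a Young diagram $Y=(m_1,\dots,m_h)$ with $h$ rows put $$\tau_{l,Y,\alpha}(x)=\det\big[I_{j+k+\alpha+m_{l-k}}(2\sqrt{x})\big]_{j,k=0}^{l-1}\quad\text{if } h\le l,\qquad \tau_{l,Y,\alpha}=0\quad\text{if } h>l,$$ where $m_{h+1}=\dots=m_l=0$. For $m\ge j\ge 1$ let $Y_{m,j}=(m-j+1,1,\dots,1)$ be the hook diagram of weight $m$ with $j$ rows. Then for every integer $m\ge 3$ and every $x\in\mathbb{C}\setminus(-\infty,0]$ (in particular for every real $x>0$; $\sqrt{x}$ is the principal square root), the functions $\tau_{l,Y_{m-1,k},\alpha}$, $1\le k\le m-1$, are differentiable at $x$, and $$\begin{pmatrix}\tau_{l,Y_{m,1},\alpha}\\ \vdots\\ \tau_{l,Y_{m,m},\alpha}\end{pmatrix} =-\sqrt{x}\,B^{(m)}\begin{pmatrix}\frac{d}{dx}\tau_{l,Y_{m-1,1},\alpha}\\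 \vdots\\ \frac{d}{dx}\tau_{l,Y_{m-1,m-1},\alpha}\\ 0\end{pmatrix} +\frac{l^2+l(\alpha-1)+m-1}{2\sqrt{x}}\,B^{(m)}\begin{pmatrix}\tau_{l,Y_{m-1,1},\alpha}\\ \vdots\\ \tau_{l,Y_{m-1,m-1},\alpha}\\ 0\end{pmatrix} -\frac{1}{\sqrt{x}}\,C_1^{(m)}\begin{pmatrix}\tau_{l,Y_{m-1,1},\alpha}\\ \vdots\\ \tau_{l,Y_{m-1,m-1},\alpha}\end{pmatrix} +C_2^{(m)}\begin{pmatrix}\tau_{l,Y_{m-2,1},\alpha}\\ \vdots\\ \tau_{l,Y_{m-2,m-2},\alpha}\end{pmatrix},$$ all functions being evaluated at $x$. Here $B^{(m)}=(b_{j,k})_{1\le j,k\le m}$, $C_1^{(m)}=(c^{(1)}_{j,k})_{1\le j\le m,\,1\le k\le m-1}$ and $C_2^{(m)}=(c^{(2)}_{j,k})_{1\le j\le m,\,1\le k\le m-2}$ are the matrices with entries $$b_{j,k}=\begin{cases}\frac{(-1)^{j+k-1}}{k(k+1)} & j\le k\le m-1,\\ -\frac1j & k=j-1,\\ 0 & k<j-1,\\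 \frac{(-1)^{j-1}}{m} & k=m,\end{cases}$$ $$c^{(1)}_{j,k}=\begin{cases}(-1)^{j+k}\Big(\frac{m-1-k}{k+1}+\frac{2l-k+\alpha}{k(k+1)}\Big) & j\le k\le m-1,\\ -\frac{1}{k+1}\big(k(2l-k+\alpha)+m-1-k\big) & k=j-1,\\ 0 & k<j-1,\end{cases}$$ $$c^{(2)}_{j,k}=\begin{cases}(-1)^{j+k}\frac{l+2}{(k+1)(k+2)} & j-1\le k\le m-2,\\ \frac{j-l-2}{j} & k=j-2,\\ 0 & k<j-2.\end{cases}$$ -/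

import Mathlib

open scoped Matrix

namespace BesselHankel

/-- The modified Bessel function of the first kind, principal branch:
`I_ν(z) = (z/2)^ν ∑_{n ≥ 0} (z²/4)^n / (n! Γ(ν + n + 1))`. -/
noncomputable def besselI (ν z : ℂ) : ℂ :=
  (z / 2) ^ ν * ∑' n : ℕ, (z ^ 2 / 4) ^ n / ((n.factorial : ℂ) * Complex.Gamma (ν + n + 1))

/-- The hook Young diagram `(m - j + 1, 1, …, 1)` with `j` rows, of weight `m`, for `1 ≤ j ≤ m`. -/
def hook (m j : ℕ) : YoungDiagram :=
  YoungDiagram.ofRowLens ((m - j + 1) :: List.replicate (j - 1) 1) <| by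
    rw [List.sortedGE_iff_pairwise, List.pairwise_cons]
    refine ⟨fun a ha => ?_, List.pairwise_replicate.2 (Or.inr le_rfl)⟩
    rw [List.eq_of_mem_replicate ha]
    omega

/-- The Hankel determinant `det [I_{j+k+α+m_{l-k}}(2√x)]_{j,k=0}^{l-1}` whose columns are shifted
by the Young diagram `Y = (m_1, …, m_h)`; it is `0` if `Y` has more than `l` rows.
Mathlib's `Y.rowLen` is indexed from `0`, and `Fin.rev k` is `l - 1 - k`, so
`Y.rowLen (Fin.rev k)` is `m_{l-k}`; `Y.colLen 0` is the number of rows. -/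
noncomputable def tau (l : ℕ) (Y : YoungDiagram) (α : ℝ) (x : ℂ) : ℂ :=
  if Y.colLen 0 ≤ l then
    Matrix.det (Matrix.of fun j k : Fin l =>
      besselI ((j : ℕ) + (k : ℕ) + α + (Y.rowLen (Fin.rev k : Fin l) : ℕ)) (2 * Complex.sqrt x))
  else 0

/-- The vector `(τ_{l,Y_{m,j},α}(x))_{j=1..m}`; the entry `i : Fin m` is the one with `j = i + 1`. -/
noncomputable def tauVec (l m : ℕ) (α : ℝ) (x : ℂ) : Fin m → ℂ :=
  fun i => tau l (hook m (i + 1)) α x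

/-- The vector `(d/dx τ_{l,Y_{m,j},α}(x))_{j=1..m}`. -/
noncomputable def derivTauVec (l m : ℕ) (α : ℝ) (x : ℂ) : Fin m → ℂ :=
  fun i => deriv (tau l (hook m (i + 1)) α) x

/-- A vector of length `m - 1` extended by a last entry `0`. -/
noncomputable def appendZero (m : ℕ) (v : Fin (m - 1) → ℂ) : Fin m → ℂ :=
  fun i => if h : (i : ℕ) < m - 1 then v ⟨i, h⟩ else 0

/-- Entries of `B^{(m)}`, with row and column indices starting at `1`. -/
noncomputable def bEntry (m j k : ℕ) : ℂ :=
  if k = m then (-1) ^ (j - 1) / m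
  else if j ≤ k then (-1) ^ (j + k - 1) / (k * (k + 1))
  else if k + 1 = j then -1 / j
  else 0

/-- Entries of `C_1^{(m)}`, with row and column indices starting at `1`. -/
noncomputable def c1Entry (l m : ℕ) (α : ℝ) (j k : ℕ) : ℂ :=
  if j ≤ k then
    (-1) ^ (j + k) * (((m : ℂ) - 1 - k) / (k + 1) + (2 * l - k + α) / (k * (k + 1)))
  else if k + 1 = j then -(1 / (k + 1)) * (k * (2 * l - k + α) + m - 1 - k)
  else 0

/-- Entries of `C_2^{(m)}`, with row and column indices starting at `1`. -/
noncomputable def c2Entry (l j k : ℕ) : ℂ :=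
  if j ≤ k + 1 then (-1) ^ (j + k) * ((l + 2) / ((k + 1) * (k + 2)))
  else if k + 2 = j then ((j : ℂ) - l - 2) / j
  else 0

/-- The matrix `B^{(m)}`. -/
noncomputable def matB (m : ℕ) : Matrix (Fin m) (Fin m) ℂ :=
  Matrix.of fun j k => bEntry m (j + 1) (k + 1)

/-- The matrix `C_1^{(m)}`. -/
noncomputable def matC1 (l m : ℕ) (α : ℝ) : Matrix (Fin m) (Fin (m - 1)) ℂ :=
  Matrix.of fun j k => c1Entry l m α (j + 1) (k + 1)

/-- The matrix `C_2^{(m)}`. -/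
noncomputable def matC2 (l m : ℕ) : Matrix (Fin m) (Fin (m - 2)) ℂ :=
  Matrix.of fun j k => c2Entry l (j + 1) (k + 1)

end BesselHankel

open BesselHankel

/-! Put `t = 1/√x` and `φ k = I_{k+α}(2√x)`. The proof uses two facts about Bessel functions: the
recurrence `φ k - φ (k+2) = t (k+1+α) φ (k+1)` and the derivative `φ k' = t φ (k+1) + (k+α)/(2x) φ
k`. By the second, differentiating a determinant gives `t` times the sum over all ways to raise one
column index (`raise`), plus a multiple of the determinant that depends only on the weight of the
diagram (`hasDerivAt_hankelDet`). It remains to express hooks of weight `m` through raised hooks of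
weight `m - 1` and plain hooks of weights `m - 1` and `m - 2`.

The relations come from symmetric function identities acting on column indices. Raising `c` distinct
columns of the one-row diagram `(a)` leaves only two determinants without repeated columns: the
hooks of weight `a + c` with `c` and `c + 1` rows, as in Pieri's rule (`sum_mul_rowExp_add_ind`).
Raising one further column either enlarges the raised set or raises one of its columns twice
(`sum_raise_ind`). The recurrence trades a double raise for no raise and a single raise weighted by
the Bessel index (`hankelDet_loop`). That index is a row part plus a column part; the row part is
evaluated by moving the shifts from columns to rows.

Together this gives one relation per `j` for the sum of the hooks with `j` and `j + 1` rows
(`hookVal_relation`). The system is bidiagonal and ends with a zero entry, so it is solved from the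
last row upwards; the matrices `B`, `C₁`, `C₂` are the coefficients of the solution
(`eq_sum_of_relation`). -/

namespace BesselHankel

/-! ### Bessel functions: recurrence and derivative at `2√x` -/

/-- The entire factor of the modified Bessel function:
`I_ν(2√x) = (√x)^ν ∑_{n ≥ 0} x^n / (n! Γ(ν + n + 1))`. -/
noncomputable def besselSeries (ν : ℝ) (x : ℂ) : ℂ :=
  ∑' n : ℕ, x ^ n / ((n.factorial : ℂ) * Complex.Gamma (ν + n + 1))

lemma sqrt_mul_self (x : ℂ) : Complex.sqrt x * Complex.sqrt x = x := by
  rw [Complex.sqrt, ← sq, ← Complex.cpow_nat_mul]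
  simp

lemma besselI_two_mul_sqrt (ν : ℝ) (x : ℂ) :
    besselI ν (2 * Complex.sqrt x) = Complex.sqrt x ^ (ν : ℂ) * besselSeries ν x := by
  have h1 : 2 * Complex.sqrt x / 2 = Complex.sqrt x := by ring
  have h2 : (2 * Complex.sqrt x) ^ 2 / 4 = x := by
    linear_combination sqrt_mul_self x
  rw [besselI, besselSeries, h1, h2]

lemma Gamma_add_nat_ge {ν : ℝ} (hν : 0 ≤ ν) (n : ℕ) :
    Real.Gamma (ν + 1) ≤ Real.Gamma (ν + n + 1) := by
  induction n with
  | zero => simp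
  | succ n ih =>
    have h : 0 < Real.Gamma (ν + n + 1) := Real.Gamma_pos_of_pos (by positivity)
    rw [show ν + (n + 1 : ℕ) + 1 = (ν + n + 1) + 1 by push_cast; ring,
      Real.Gamma_add_one (s := ν + n + 1) (add_pos_of_nonneg_of_pos (by positivity) one_pos).ne']
    have : 0 ≤ ν + n := by positivity
    nlinarith

lemma ofReal_Gamma_add (ν : ℝ) (n : ℕ) :
    Complex.Gamma (ν + n + 1) = (Real.Gamma (ν + n + 1) : ℝ) := by
  rw [← Complex.Gamma_ofReal]
  push_cast
  rfl

lemma Gamma_add_ne_zero {ν : ℝ} (hν : 0 ≤ ν) (n : ℕ) : Complex.Gamma (ν + n + 1) ≠ 0 := by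
  rw [ofReal_Gamma_add, Complex.ofReal_ne_zero]
  exact (Real.Gamma_pos_of_pos (by positivity)).ne'

lemma Gamma_add_succ {ν : ℝ} (hν : 0 ≤ ν) (n : ℕ) :
    Complex.Gamma (ν + n + 1 + 1) = (ν + n + 1) * Complex.Gamma (ν + n + 1) := by
  refine Complex.Gamma_add_one _ ?_
  have : (ν + n + 1 : ℝ) ≠ 0 := by positivity
  exact_mod_cast this

lemma norm_besselSeries_term_le {ν : ℝ} (hν : 0 ≤ ν) (n : ℕ) (x : ℂ) :
    ‖x ^ n / ((n.factorial : ℂ) * Complex.Gamma (ν + n + 1))‖ ≤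
      ‖x‖ ^ n / n.factorial * (Real.Gamma (ν + 1))⁻¹ := by
  have h0 : 0 < Real.Gamma (ν + 1) := Real.Gamma_pos_of_pos (by positivity)
  have h := Gamma_add_nat_ge hν n
  rw [ofReal_Gamma_add, norm_div, norm_mul, norm_pow, Complex.norm_real, Complex.norm_natCast,
    Real.norm_of_nonneg (h0.le.trans h), ← div_div, ← div_eq_mul_inv]
  gcongr

lemma summable_besselSeries {ν : ℝ} (hν : 0 ≤ ν) (x : ℂ) :
    Summable fun n : ℕ => x ^ n / ((n.factorial : ℂ) * Complex.Gamma (ν + n + 1)) :=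
  .of_norm_bounded ((Real.summable_pow_div_factorial ‖x‖).mul_right _)
    fun n => norm_besselSeries_term_le hν n x

/-- Compare coefficients of `x^(n+1)`: over the common denominator `(n+1)! Γ(ν+n+3)` the left side
has numerator `(ν+n+2) - (n+1) = ν+1`. The assumption `0 ≤ ν` keeps all Gamma arguments away from
the poles. -/
lemma besselSeries_recurrence {ν : ℝ} (hν : 0 ≤ ν) (x : ℂ) :
    besselSeries ν x - x * besselSeries (ν + 2) x = (ν + 1) * besselSeries (ν + 1) x := by
  have h0 := (summable_besselSeries hν x)
  have h1 := (summable_besselSeries (ν := ν + 1) (by positivity) x)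
  have h2 := (summable_besselSeries (ν := ν + 2) (by positivity) x)
  unfold besselSeries
  rw [h0.tsum_eq_zero_add, h1.tsum_eq_zero_add, mul_add, ← tsum_mul_left, ← tsum_mul_left,
    add_sub_assoc, ← Summable.tsum_sub ((summable_nat_add_iff 1).2 h0) (h2.mul_left x)]
  congr 1
  · have hG := Gamma_add_succ hν 0
    have hne := Gamma_add_ne_zero hν 0
    have hν' : (ν + 1 : ℂ) ≠ 0 := by exact_mod_cast (by positivity : (ν + 1 : ℝ) ≠ 0)
    simp only [Nat.cast_zero, add_zero] at hG hne
    simp only [pow_zero, Nat.factorial_zero, Nat.cast_one, one_mul, Nat.cast_zero, add_zero]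
    push_cast
    rw [hG]
    field_simp
  · refine tsum_congr fun n => ?_
    have hG1 := Gamma_add_succ hν (n + 1)
    have hne := Gamma_add_ne_zero hν (n + 1)
    have hn' : (n + 1 : ℂ) ≠ 0 := by exact_mod_cast n.succ_ne_zero
    have hf : (n.factorial : ℂ) ≠ 0 := by exact_mod_cast n.factorial_ne_zero
    have hν' : (ν + n + 1 + 1 : ℂ) ≠ 0 := by
      exact_mod_cast (by positivity : (ν + n + 1 + 1 : ℝ) ≠ 0)
    push_cast [Nat.factorial_succ] at *
    rw [show (ν : ℂ) + 1 + (n + 1) + 1 = ν + (n + 1) + 1 + 1 by ring,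
      show (ν : ℂ) + 2 + n + 1 = ν + (n + 1) + 1 + 1 by ring, hG1,
      show (ν : ℂ) + (n + 1) + 1 = ν + n + 1 + 1 by ring] at *
    field_simp
    ring

/-- Termwise differentiation, dominated on the ball of radius `‖x‖ + 1` by an exponential series
because `Γ(ν+n+1) ≥ Γ(ν+1)`. -/
lemma hasDerivAt_besselSeries {ν : ℝ} (hν : 0 ≤ ν) (x : ℂ) :
    HasDerivAt (besselSeries ν) (besselSeries (ν + 1) x) x := by
  have hν1 : 0 ≤ ν + 1 := by positivity
  let d : ℕ → ℂ → ℂ := fun n y =>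
    (n * y ^ (n - 1)) / ((n.factorial : ℂ) * Complex.Gamma (ν + n + 1))
  have hd : ∀ n y, d (n + 1) y =
      y ^ n / ((n.factorial : ℂ) * Complex.Gamma ((ν + 1 : ℝ) + n + 1)) := by
    intro n y
    have hn' : (n + 1 : ℂ) ≠ 0 := by exact_mod_cast n.succ_ne_zero
    simp only [d, Nat.factorial_succ, Nat.add_sub_cancel]
    push_cast
    rw [show (ν : ℂ) + 1 + n + 1 = ν + (n + 1) + 1 by ring, mul_assoc (n + 1 : ℂ),
      mul_div_mul_left _ _ hn']
  have hsum : ∑' n, d n x = besselSeries (ν + 1) x := by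
    have hs : Summable fun n => d n x := by
      rw [← summable_nat_add_iff 1]
      simpa only [hd] using summable_besselSeries hν1 x
    rw [hs.tsum_eq_zero_add, besselSeries]
    simp only [hd]
    simp [d]
  have hbound : Summable fun n : ℕ =>
      (n : ℝ) * (‖x‖ + 1) ^ (n - 1) / n.factorial * (Real.Gamma (ν + 1))⁻¹ := by
    refine Summable.mul_right _ ?_
    rw [← summable_nat_add_iff 1]
    refine (Real.summable_pow_div_factorial (‖x‖ + 1)).congr fun n => ?_
    have hn' : (n + 1 : ℝ) ≠ 0 := by positivity
    have hf : (n.factorial : ℝ) ≠ 0 := by positivity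
    simp only [Nat.factorial_succ, Nat.add_sub_cancel]
    push_cast
    field_simp
  rw [← hsum]
  refine hasDerivAt_tsum_of_isPreconnected (t := Metric.ball 0 (‖x‖ + 1)) hbound
    Metric.isOpen_ball (convex_ball _ _).isPreconnected ?_ ?_ (y₀ := x) (by simp)
    (summable_besselSeries hν x) (by simp)
  · intro n y _
    exact (hasDerivAt_pow n y).div_const _
  · intro n y hy
    have h0 : 0 < Real.Gamma (ν + 1) := Real.Gamma_pos_of_pos (by positivity)
    have h := Gamma_add_nat_ge hν n
    have hy' : ‖y‖ ≤ ‖x‖ + 1 := by simpa using (Metric.mem_ball.1 hy).le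
    simp only [d]
    rw [ofReal_Gamma_add, norm_div, norm_mul, norm_mul, norm_pow, Complex.norm_real,
      Complex.norm_natCast, Complex.norm_natCast, Real.norm_of_nonneg (h0.le.trans h), ← div_div,
      ← div_eq_mul_inv]
    gcongr

lemma sqrt_ne_zero {x : ℂ} (hx : x ∈ Complex.slitPlane) : Complex.sqrt x ≠ 0 := fun h =>
  Complex.slitPlane_ne_zero hx (by rw [← sqrt_mul_self x, h, zero_mul])

/-- The three-term recurrence `I_ν - I_{ν+2} = (2 (ν + 1) / z) I_{ν+1}` at `z = 2√x`. -/
lemma besselI_recurrence {ν : ℝ} (hν : 0 ≤ ν) {x : ℂ} (hx : x ∈ Complex.slitPlane) :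
    besselI ν (2 * Complex.sqrt x) - besselI (ν + 2 : ℝ) (2 * Complex.sqrt x) =
      (1 / Complex.sqrt x) * ((ν + 1) * besselI (ν + 1 : ℝ) (2 * Complex.sqrt x)) := by
  have hs := sqrt_ne_zero hx
  have hss := sqrt_mul_self x
  have h := besselSeries_recurrence hν x
  simp only [besselI_two_mul_sqrt]
  have h2 : Complex.sqrt x ^ ((ν + 2 : ℝ) : ℂ) = Complex.sqrt x ^ (ν : ℂ) * x := by
    push_cast
    rw [Complex.cpow_add _ _ hs, Complex.cpow_ofNat, pow_two, hss]
  have h1 : Complex.sqrt x ^ ((ν + 1 : ℝ) : ℂ) = Complex.sqrt x ^ (ν : ℂ) * Complex.sqrt x := by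
    push_cast
    rw [Complex.cpow_add _ _ hs, Complex.cpow_one]
  rw [h1, h2]
  field_simp
  linear_combination (Complex.sqrt x ^ (ν : ℂ)) * h

lemma hasDerivAt_besselI_two_mul_sqrt {ν : ℝ} (hν : 0 ≤ ν) {x : ℂ}
    (hx : x ∈ Complex.slitPlane) :
    HasDerivAt (fun y => besselI ν (2 * Complex.sqrt y))
      ((1 / Complex.sqrt x) * besselI (ν + 1 : ℝ) (2 * Complex.sqrt x) +
        ν / (2 * x) * besselI ν (2 * Complex.sqrt x)) x := by
  have hs := sqrt_ne_zero hx
  have hx0 := Complex.slitPlane_ne_zero hx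
  have hss := sqrt_mul_self x
  simp only [besselI_two_mul_sqrt]
  have h1 : Complex.sqrt x ^ ((ν + 1 : ℝ) : ℂ) = Complex.sqrt x ^ (ν : ℂ) * Complex.sqrt x := by
    push_cast
    rw [Complex.cpow_add _ _ hs, Complex.cpow_one]
  -- Off the cut the principal root lies in the open right half-plane, so the outer power `(√x)^ν`
  -- is differentiable there too.
  have hre : 0 < (Complex.sqrt x).re := by
    rw [Complex.sqrt, Complex.cpow_inv_two_re]
    refine Real.sqrt_pos.2 (half_pos ?_)
    rcases Complex.mem_slitPlane_iff.1 hx with h | h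
    · positivity
    · linarith [neg_abs_le x.re, Complex.abs_re_lt_norm.2 h]
  have hsd : HasDerivAt Complex.sqrt (Complex.sqrt x / (2 * x)) x := by
    convert! Complex.hasDerivAt_sqrt hx using 1
    rw [show (-1 / 2 : ℂ) = 2⁻¹ - 1 by norm_num, Complex.cpow_sub _ _ hx0, Complex.cpow_one,
      ← Complex.sqrt]
    field_simp
  have hd : HasDerivAt (fun y => Complex.sqrt y ^ (ν : ℂ))
      (ν / (2 * x) * Complex.sqrt x ^ (ν : ℂ)) x := by
    convert! hsd.cpow_const (c := (ν : ℂ)) (Or.inl hre) using 1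
    rw [Complex.cpow_sub _ _ hs, Complex.cpow_one]
    field_simp
  convert! hd.mul (hasDerivAt_besselSeries hν x) using 1
  rw [h1]
  field_simp
  ring

open Finset

/-! ### Raising column indices of a determinant -/

section ColumnShifts

variable {l : ℕ}

/-- The indicator function of a set of columns. -/
def ind (S : Finset (Fin l)) : Fin l → ℕ := fun k => if k ∈ S then 1 else 0

/-- The function with the value `b` at the column `i` and zero elsewhere. -/
def bump (i : Fin l) (b : ℕ) : Fin l → ℕ := fun k => if k = i then b else 0

lemma bump_add (i : Fin l) (b c : ℕ) : bump i (b + c) = bump i b + bump i c := by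
  ext k
  by_cases h : k = i <;> simp [bump, h]

lemma bump_zero (i : Fin l) : bump i 0 = 0 := by
  ext k
  simp [bump]

/-- The determinant `det [φ_{r_j + n_k}]`. -/
noncomputable def hankelDet (φ : ℕ → ℂ) (r n : Fin l → ℕ) : ℂ :=
  Matrix.det (Matrix.of fun j k => φ (r j + n k))

lemma hankelDet_eq_sum (φ : ℕ → ℂ) (r n : Fin l → ℕ) :
    hankelDet φ r n =
      ∑ σ : Equiv.Perm (Fin l), (Equiv.Perm.sign σ : ℂ) * ∏ k, φ (r (σ k) + n k) := by
  simp [hankelDet, Matrix.det_apply']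

lemma hankelDet_eq_zero {φ : ℕ → ℂ} {r n : Fin l → ℕ} (h : ¬ Function.Injective n) :
    hankelDet φ r n = 0 := by
  simp only [Function.Injective, not_forall] at h
  obtain ⟨p, q, hpq, hne⟩ := h
  exact Matrix.det_zero_of_column_eq hne fun j => by simp [hpq]

lemma hankelDet_eq_zero_of_row {φ : ℕ → ℂ} {r n : Fin l → ℕ} (h : ¬ Function.Injective r) :
    hankelDet φ r n = 0 := by
  simp only [Function.Injective, not_forall] at h
  obtain ⟨p, q, hpq, hne⟩ := h
  exact Matrix.det_zero_of_row_eq hne (by ext k; simp [hpq])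

lemma hankelDet_comp_swap (φ : ℕ → ℂ) (r n : Fin l → ℕ) {p q : Fin l} (hpq : p ≠ q) :
    hankelDet φ r (n ∘ Equiv.swap p q) = -hankelDet φ r n := by
  have h := Matrix.det_permute' (Equiv.swap p q) (Matrix.of fun j k => φ (r j + n k))
  rw [Equiv.Perm.sign_swap hpq] at h
  simpa [hankelDet, Matrix.submatrix] using h

/-- The sum of the values of `F` over all ways to raise one entry of the argument by one. -/
noncomputable def raise (F : (Fin l → ℕ) → ℂ) (n : Fin l → ℕ) : ℂ :=
  ∑ i, F (n + bump i 1)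

/-- If columns `p` and `q` agree, raising `p` and raising `q` give determinants that differ by a
column swap and cancel; every other term keeps two equal columns. -/
lemma raise_hankelDet_eq_zero {φ : ℕ → ℂ} {r n : Fin l → ℕ} (h : ¬ Function.Injective n) :
    raise (hankelDet φ r) n = 0 := by
  simp only [Function.Injective, not_forall] at h
  obtain ⟨p, q, hpq, hne⟩ := h
  have hswap : (n + bump p 1) ∘ Equiv.swap p q = n + bump q 1 := by
    ext k
    rcases eq_or_ne k p with rfl | hkp
    · simp [bump, hne, Ne.symm hne, hpq]
    rcases eq_or_ne k q with rfl | hkq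
    · simp [bump, hpq]
    · simp [bump, Equiv.swap_apply_of_ne_of_ne hkp hkq, hkp, hkq]
  have h1 := hankelDet_comp_swap φ r (n + bump p 1) hne
  rw [hswap] at h1
  rw [raise, Fintype.sum_eq_add p q hne, h1, add_neg_cancel]
  rintro k ⟨hkp, hkq⟩
  refine hankelDet_eq_zero fun hinj => hne (hinj ?_)
  simp [bump, hpq, hkp.symm, hkq.symm]

lemma sum_powersetCard_sum_compl {M : Type*} [AddCommMonoid M] (c : ℕ)
    (f : Fin l → Finset (Fin l) → M) :
    ∑ S ∈ powersetCard c univ, ∑ i ∈ Sᶜ, f i S =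
      ∑ S ∈ powersetCard (c + 1) univ, ∑ i ∈ S, f i (S.erase i) := by
  rw [sum_sigma', sum_sigma']
  refine sum_bij' (fun x _ => ⟨insert x.2 x.1, x.2⟩) (fun x _ => ⟨x.1.erase x.2, x.2⟩) ?_ ?_ ?_ ?_ ?_
  · rintro ⟨S, i⟩ h
    simp only [mem_sigma, mem_powersetCard_univ, mem_compl] at h ⊢
    exact ⟨by rw [card_insert_of_notMem h.2, h.1], mem_insert_self _ _⟩
  · rintro ⟨S, i⟩ h
    simp only [mem_sigma, mem_powersetCard_univ, mem_compl] at h ⊢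
    exact ⟨by rw [card_erase_of_mem h.2, h.1]; rfl, notMem_erase _ _⟩
  · rintro ⟨S, i⟩ h
    simp only [mem_sigma, mem_powersetCard_univ, mem_compl] at h
    simp [erase_insert h.2]
  · rintro ⟨S, i⟩ h
    simp only [mem_sigma, mem_powersetCard_univ] at h
    simp [insert_erase h.2]
  · rintro ⟨S, i⟩ h
    simp only [mem_sigma, mem_powersetCard_univ, mem_compl] at h
    simp [erase_insert h.2]

lemma ind_erase_add_single {S : Finset (Fin l)} {i : Fin l} (hi : i ∈ S) :
    ind (S.erase i) + bump i 1 = ind S := by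
  ext k
  rcases eq_or_ne k i with rfl | h
  · simp [ind, bump, hi]
  · simp [ind, bump, h]

/-- The analogue of `e₁ e_{c+1} = (c+2) e_{c+2} + m_{(2,1^c)}`: a set of `c + 2` columns arises once
for each of its elements taken as the last one raised. -/
lemma sum_raise_ind (F : (Fin l → ℕ) → ℂ) (n : Fin l → ℕ) (c : ℕ) :
    ∑ S ∈ powersetCard (c + 1) univ, raise F (n + ind S) =
      (c + 2) * ∑ S ∈ powersetCard (c + 2) univ, F (n + ind S) +
        ∑ S ∈ powersetCard c univ, ∑ i ∈ Sᶜ, F (n + ind S + bump i 2) := by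
  have h1 : ∀ S : Finset (Fin l), raise F (n + ind S) =
      ∑ i ∈ Sᶜ, F (n + ind S + bump i 1) + ∑ i ∈ S, F (n + ind S + bump i 1) :=
    fun S => (sum_compl_add_sum S _).symm
  simp only [h1, sum_add_distrib]
  rw [sum_powersetCard_sum_compl (c + 1) fun i S => F (n + ind S + bump i 1),
    sum_powersetCard_sum_compl c fun i S => F (n + ind S + bump i 2), mul_sum]
  congr 1
  · refine sum_congr rfl fun S hS => ?_
    have hc : (S.card : ℂ) = c + 2 := by
      rw [mem_powersetCard_univ.1 hS]; push_cast; ring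
    rw [← hc, ← nsmul_eq_mul, ← sum_const]
    refine sum_congr rfl fun i hi => ?_
    rw [add_assoc, ind_erase_add_single hi]
  · refine sum_congr rfl fun S _ => sum_congr rfl fun i hi => ?_
    rw [← ind_erase_add_single hi, add_assoc, add_assoc, add_assoc, ← bump_add]

lemma raise_eq_sum_ind (F : (Fin l → ℕ) → ℂ) (n : Fin l → ℕ) :
    raise F n = ∑ S ∈ powersetCard 1 univ, F (n + ind S) := by
  rw [powersetCard_one, sum_map, raise]
  refine sum_congr rfl fun i _ => ?_
  congr 2
  ext k
  simp [ind, bump]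

lemma sum_powersetCard_perm {M : Type*} [AddCommMonoid M] (c : ℕ) (σ : Equiv.Perm (Fin l))
    (f : Finset (Fin l) → M) :
    ∑ S ∈ powersetCard c univ, f (S.map σ.toEmbedding) = ∑ S ∈ powersetCard c univ, f S := by
  refine sum_equiv σ.finsetCongr (fun S => ?_) fun S _ => rfl
  simp

/-- In the Leibniz term of `σ`, shifting the columns in `S` is the same as shifting the rows in
`σ(S)`, and `S ↦ σ(S)` permutes the sets of size `c`. This turns weights that depend on rows into
honest sums of determinants. -/
lemma sum_weight_perm (φ : ℕ → ℂ) (r n : Fin l → ℕ) (w : Fin l → ℂ) (c : ℕ) :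
    ∑ S ∈ powersetCard c univ, ∑ σ : Equiv.Perm (Fin l),
        (Equiv.Perm.sign σ : ℂ) * ((∑ k ∈ S, w (σ k)) * ∏ k, φ (r (σ k) + (n + ind S) k)) =
      ∑ S ∈ powersetCard c univ, (∑ k ∈ S, w k) * hankelDet φ (r + ind S) n := by
  simp only [hankelDet_eq_sum, mul_sum (s := univ)]
  rw [sum_comm, sum_comm (s := powersetCard c univ) (t := univ)]
  refine sum_congr rfl fun σ _ => ?_
  rw [← sum_powersetCard_perm c σ fun S =>
    (∑ k ∈ S, w k) * ((Equiv.Perm.sign σ : ℂ) * ∏ k, φ ((r + ind S) (σ k) + n k))]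
  refine sum_congr rfl fun S _ => ?_
  rw [sum_map]
  simp only [Equiv.coe_toEmbedding]
  rw [mul_left_comm]
  congr 3
  ext k
  congr 1
  simp only [Pi.add_apply, ind, mem_map_equiv, Equiv.symm_apply_apply]
  ring

lemma sum_hankelDet_ind (φ : ℕ → ℂ) (r n : Fin l → ℕ) (c : ℕ) :
    ∑ S ∈ powersetCard c univ, hankelDet φ r (n + ind S) =
      ∑ S ∈ powersetCard c univ, hankelDet φ (r + ind S) n := by
  simp only [hankelDet_eq_sum]
  rw [sum_comm, sum_comm (s := powersetCard c univ) (t := univ)]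
  refine sum_congr rfl fun σ _ => ?_
  rw [← sum_powersetCard_perm c σ fun S =>
    (Equiv.Perm.sign σ : ℂ) * ∏ k, φ ((r + ind S) (σ k) + n k)]
  refine sum_congr rfl fun S _ => ?_
  congr 2
  ext k
  congr 1
  simp only [Pi.add_apply, ind, mem_map_equiv, Equiv.symm_apply_apply]
  ring

variable {φ : ℕ → ℂ} {t a : ℂ}

lemma prod_sub_prod (hφ : ∀ k : ℕ, φ k - φ (k + 2) = t * ((k + 1 + a) * φ (k + 1)))
    (v : Fin l → ℕ) (S : Finset (Fin l)) {i : Fin l} (hi : i ∈ S) :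
    ∏ k, φ ((v + ind (S.erase i)) k) - ∏ k, φ ((v + ind (S.erase i) + bump i 2) k) =
      t * ((v i + 1 + a) * ∏ k, φ ((v + ind S) k)) := by
  rw [← ind_erase_add_single hi, ← add_assoc]
  set u := v + ind (S.erase i) with hu
  have hui : u i = v i := by simp [hu, ind]
  have key : ∀ b : ℕ, ∏ k, φ ((u + bump i b) k) = φ (u i + b) * ∏ k ∈ univ.erase i, φ (u k) := by
    intro b
    rw [← mul_prod_erase univ _ (mem_univ i)]
    congr 1
    · simp [bump]
    · refine prod_congr rfl fun k hk => ?_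
      simp [bump, (mem_erase.1 hk).1]
  have h0 := key 0
  rw [bump_zero, add_zero, add_zero] at h0
  rw [h0, key 1, key 2, ← sub_mul, hφ, hui]
  ring

/-- Apply the recurrence to the factor of column `i` in each Leibniz term. Its coefficient `r (σ i)
+ n i + 1 + a` splits into a column weight, a row weight (moved to rows by `sum_weight_perm`) and a
constant. -/
lemma hankelDet_loop (hφ : ∀ k : ℕ, φ k - φ (k + 2) = t * ((k + 1 + a) * φ (k + 1)))
    (r n : Fin l → ℕ) (c : ℕ) :
    ∑ S ∈ powersetCard c univ, ∑ i ∈ Sᶜ,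
        (hankelDet φ r (n + ind S) - hankelDet φ r (n + ind S + bump i 2)) =
      t * (∑ S ∈ powersetCard (c + 1) univ,
          (∑ k ∈ S, (n k : ℂ)) * hankelDet φ r (n + ind S) +
        ∑ S ∈ powersetCard (c + 1) univ,
          (∑ k ∈ S, (r k : ℂ)) * hankelDet φ (r + ind S) n +
        (c + 1) * (1 + a) * ∑ S ∈ powersetCard (c + 1) univ, hankelDet φ r (n + ind S)) := by
  rw [sum_powersetCard_sum_compl c fun i S =>
      hankelDet φ r (n + ind S) - hankelDet φ r (n + ind S + bump i 2),
    ← sum_weight_perm, mul_sum (a := (c + 1) * (1 + a)), ← sum_add_distrib, ← sum_add_distrib,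
    mul_sum]
  refine sum_congr rfl fun S hS => ?_
  have hc : (S.card : ℂ) = c + 1 := by
    rw [mem_powersetCard_univ.1 hS]; push_cast; ring
  simp only [hankelDet_eq_sum, ← sum_sub_distrib, mul_sum (s := univ), ← sum_add_distrib]
  rw [sum_comm]
  refine sum_congr rfl fun σ _ => ?_
  have h : ∀ i ∈ S, ∏ k, φ (r (σ k) + (n + ind (S.erase i)) k) -
      ∏ k, φ (r (σ k) + (n + ind (S.erase i) + bump i 2) k) =
      t * (((n i + r (σ i) : ℂ) + (1 + a)) * ∏ k, φ (r (σ k) + (n + ind S) k)) := by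
    intro i hi
    have := prod_sub_prod hφ (fun k => r (σ k) + n k) S hi
    simp only [Pi.add_apply, add_assoc] at this ⊢
    rw [this]
    push_cast
    ring
  simp only [← mul_sub]
  rw [← mul_sum, sum_congr rfl h, ← mul_sum, ← sum_mul, sum_add_distrib, sum_add_distrib, sum_const,
    nsmul_eq_mul, hc]
  ring

end ColumnShifts

/-! ### Pieri's rule for hooks and the resulting relations -/

section Hooks

variable {l : ℕ}

/-- The columns `d, d + 1, …, d + c - 1`. -/
def seg (l d c : ℕ) : Finset (Fin l) := univ.filter fun k => d ≤ (k : ℕ) ∧ (k : ℕ) < d + c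

lemma mem_seg {d c : ℕ} {k : Fin l} : k ∈ seg l d c ↔ d ≤ (k : ℕ) ∧ (k : ℕ) < d + c := by
  simp [seg]

lemma map_val_seg {d c : ℕ} (h : d + c ≤ l) : (seg l d c).map Fin.valEmbedding = Ico d (d + c) := by
  ext k
  simp only [mem_map, mem_seg, Fin.valEmbedding_apply, mem_Ico]
  refine ⟨?_, fun hk => ⟨⟨k, by omega⟩, hk, rfl⟩⟩
  rintro ⟨k, hk, rfl⟩
  exact hk

lemma card_seg {d c : ℕ} (h : d + c ≤ l) : (seg l d c).card = c := by
  rw [← card_map Fin.valEmbedding, map_val_seg h, Nat.card_Ico, Nat.add_sub_cancel_left]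

lemma sum_seg {d c : ℕ} (h : d + c ≤ l) (f : ℕ → ℂ) :
    ∑ k ∈ seg l d c, f k = ∑ k ∈ Ico d (d + c), f k := by
  rw [← map_val_seg h, sum_map]
  rfl

lemma sum_Ico_cast (d c : ℕ) :
    ∑ k ∈ Ico d (d + c), (k : ℂ) = c * (2 * d + c - 1) / 2 := by
  induction c with
  | zero => simp
  | succ c ih =>
    rw [← add_assoc, sum_Ico_succ_top (by omega), ih]
    push_cast
    ring

lemma eq_seg_of_upward_closed {N : ℕ} (hN : N ≤ l) {S : Finset (Fin l)}
    (hlt : ∀ k ∈ S, (k : ℕ) < N)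
    (hup : ∀ k ∈ S, ∀ k' : Fin l, (k' : ℕ) = k + 1 → (k' : ℕ) < N → k' ∈ S) :
    S.card ≤ N ∧ S = seg l (N - S.card) S.card := by
  rcases S.eq_empty_or_nonempty with rfl | hne
  · refine ⟨by simp, ?_⟩
    ext k
    simp only [mem_seg, card_empty, notMem_empty, false_iff]
    omega
  have hmin := S.min'_mem hne
  set p := S.min' hne with hp
  have hmem : ∀ b : ℕ, ∀ h : (p : ℕ) + b < N, (⟨p + b, h.trans_le hN⟩ : Fin l) ∈ S := by
    intro b
    induction b with
    | zero => intro _; exact hmin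
    | succ b ih => exact fun h => hup _ (ih (by omega)) _ rfl h
  have hpN := hlt p hmin
  have hS : S = seg l p (N - p) := by
    ext k
    rw [mem_seg]
    constructor
    · intro hk
      have h1 : (p : ℕ) ≤ k := S.min'_le k hk
      have h2 := hlt k hk
      omega
    · rintro ⟨h1, h2⟩
      have := hmem (k - p) (by omega)
      convert! this
      omega
  have hc : S.card = N - p := by
    rw [hS, card_seg (by omega)]
  refine ⟨by omega, ?_⟩
  rw [hc, show N - (N - (p : ℕ)) = p by omega]
  exact hS

/-- The exponents `0, 1, …, l - 1` with the last one raised by `a`. -/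
def rowExp (l a : ℕ) : Fin l → ℕ := fun k => k + if (k : ℕ) + 1 = l then a else 0

/-- The exponents `0, 1, …, l - 1` shifted by the hook of weight `m` with `j` rows. -/
def hookExp (l m j : ℕ) : Fin l → ℕ := fun k =>
  k + if (k : ℕ) + 1 = l then m - j + 1 else if l ≤ k + j then 1 else 0

/-- The value of `F` at the hook of weight `m` with `j` rows, and `0` unless `1 ≤ j ≤ m, l`. -/
noncomputable def hookVal (F : (Fin l → ℕ) → ℂ) (m j : ℕ) : ℂ :=
  if 1 ≤ j ∧ j ≤ m ∧ j ≤ l then F (hookExp l m j) else 0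

/-- Raising a column whose right neighbour sits one higher and is not raised creates a collision. So
the raised columns form a block, ending at the last column (first alternative) or just before it
(second); the latter needs the gap `1 ≤ a` unless the block is empty. -/
lemma eq_seg_of_injective (hl : 1 ≤ l) {a : ℕ} {S : Finset (Fin l)}
    (hinj : Function.Injective (rowExp l a + ind S)) :
    (S.card ≤ l ∧ S = seg l (l - S.card) S.card) ∨
      ((1 ≤ a ∨ S.card = 0) ∧ S.card + 1 ≤ l ∧ S = seg l (l - 1 - S.card) S.card) := by
  have hup : ∀ k ∈ S, ∀ k' : Fin l, (k' : ℕ) = k + 1 → (k' : ℕ) + 1 < l ∨ a = 0 → k' ∈ S := by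
    intro k hk k' hkk' ha
    by_contra hk'
    have h : k = k' := hinj (by
      simp only [Pi.add_apply, rowExp, ind, hk, hk', if_true, if_false]
      split_ifs <;> omega)
    omega
  by_cases hlast : (⟨l - 1, by omega⟩ : Fin l) ∈ S
  · left
    refine eq_seg_of_upward_closed le_rfl (fun k _ => k.2) fun k hk k' hkk' _ => ?_
    by_cases h : (k' : ℕ) + 1 < l
    · exact hup k hk k' hkk' (Or.inl h)
    · convert! hlast
      have := k'.2
      omega
  · right
    have hlt : ∀ k ∈ S, (k : ℕ) < l - 1 := by
      intro k hk
      have hk2 := k.2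
      have : (k : ℕ) ≠ l - 1 := fun h => hlast (by
        convert! hk
        exact h.symm)
      omega
    have := eq_seg_of_upward_closed (N := l - 1) (by omega) hlt fun k hk k' hkk' h =>
      hup k hk k' hkk' (Or.inl (by omega))
    refine ⟨?_, by omega, this.2⟩
    by_contra! h
    have hS : (⟨l - 2, by omega⟩ : Fin l) ∈ S := by
      rw [this.2, mem_seg]
      simp only
      omega
    exact hlast (hup _ hS _ (by simp only; omega) (Or.inr (by omega)))

lemma rowExp_add_ind_seg_top {a c : ℕ} (hc : 1 ≤ c) (hcl : c ≤ l) :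
    rowExp l a + ind (seg l (l - c) c) = hookExp l (a + c) c := by
  ext k
  have := k.2
  simp only [Pi.add_apply, rowExp, ind, mem_seg, hookExp]
  split_ifs <;> omega

lemma rowExp_add_ind_seg_below {a c : ℕ} (ha : 1 ≤ a) (hcl : c + 1 ≤ l) :
    rowExp l a + ind (seg l (l - 1 - c) c) = hookExp l (a + c) (c + 1) := by
  ext k
  have := k.2
  simp only [Pi.add_apply, rowExp, ind, mem_seg, hookExp]
  split_ifs <;> omega

/-- Pieri's rule with weights: only the two blocks of `eq_seg_of_injective` survive. If a block does
not fit, its truncated endpoint is harmless since its `hookVal` is zero. The case `a = c = 0` is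
excluded because the empty diagram is not a hook. -/
lemma sum_mul_rowExp_add_ind (hl : 1 ≤ l) {F : (Fin l → ℕ) → ℂ}
    (hF : ∀ n, ¬ Function.Injective n → F n = 0) {a c : ℕ} (hac : 1 ≤ a ∨ 1 ≤ c)
    (w : Finset (Fin l) → ℂ) :
    ∑ S ∈ powersetCard c univ, w S * F (rowExp l a + ind S) =
      w (seg l (l - c) c) * hookVal F (a + c) c +
        w (seg l (l - 1 - c) c) * hookVal F (a + c) (c + 1) := by
  rcases Nat.eq_zero_or_pos c with rfl | hc
  · have ha : 1 ≤ a := by omega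
    have hS : seg l (l - 1 - 0) 0 = ∅ := by
      ext k
      simp [mem_seg]
    have h := rowExp_add_ind_seg_below ha (c := 0) (by omega : 0 + 1 ≤ l)
    have h1 : 1 ≤ a + 0 := by omega
    rw [hS] at h ⊢
    simp [hookVal, powersetCard_zero, h, hl, ha]
  have htop : ∀ hcl : c ≤ l, hookVal F (a + c) c = F (rowExp l a + ind (seg l (l - c) c)) := by
    intro hcl
    rw [hookVal, if_pos ⟨hc, by omega, hcl⟩, rowExp_add_ind_seg_top hc hcl]
  by_cases hcl : c ≤ l
  swap
  · rw [powersetCard_eq_empty.2 (by simpa using hcl), sum_empty, hookVal, if_neg (by omega), hookVal,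
      if_neg (by omega)]
    simp
  by_cases h2 : 1 ≤ a ∧ c + 1 ≤ l
  · have hbelow : hookVal F (a + c) (c + 1) = F (rowExp l a + ind (seg l (l - 1 - c) c)) := by
      rw [hookVal, if_pos ⟨by omega, by omega, h2.2⟩, rowExp_add_ind_seg_below h2.1 h2.2]
    have hne : seg l (l - c) c ≠ seg l (l - 1 - c) c := by
      intro h
      have hm : (⟨l - 1, by omega⟩ : Fin l) ∈ seg l (l - c) c := by
        rw [mem_seg]; simp only; omega
      rw [h, mem_seg] at hm
      simp only at hm
      omega
    rw [htop hcl, hbelow]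
    refine sum_eq_add_of_mem _ _ (mem_powersetCard_univ.2 (card_seg (by omega)))
      (mem_powersetCard_univ.2 (card_seg (by omega))) hne fun S hS hSne => ?_
    rw [hF, mul_zero]
    intro hinj
    have := eq_seg_of_injective hl hinj
    rw [mem_powersetCard_univ.1 hS] at this
    rcases this with h | h
    · exact hSne.1 h.2
    · exact hSne.2 h.2.2
  · rw [htop hcl, hookVal, if_neg (by omega), mul_zero, add_zero]
    refine sum_eq_single_of_mem _ (mem_powersetCard_univ.2 (card_seg (by omega))) fun S hS hSne => ?_
    rw [hF, mul_zero]
    intro hinj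
    have := eq_seg_of_injective hl hinj
    rw [mem_powersetCard_univ.1 hS] at this
    rcases this with h | h
    · exact hSne h.2
    · exact h2 ⟨by omega, h.2.1⟩

lemma sum_rowExp_add_ind (hl : 1 ≤ l) {F : (Fin l → ℕ) → ℂ}
    (hF : ∀ n, ¬ Function.Injective n → F n = 0) {a c : ℕ} (hac : 1 ≤ a ∨ 1 ≤ c) :
    ∑ S ∈ powersetCard c univ, F (rowExp l a + ind S) =
      hookVal F (a + c) c + hookVal F (a + c) (c + 1) := by
  simpa using sum_mul_rowExp_add_ind hl hF hac fun _ => 1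

lemma sum_weight_rowExp_add_ind (hl : 1 ≤ l) {F : (Fin l → ℕ) → ℂ}
    (hF : ∀ n, ¬ Function.Injective n → F n = 0) {a c : ℕ} (hc : 1 ≤ c) :
    ∑ S ∈ powersetCard c univ, (∑ k ∈ S, (rowExp l a k : ℂ)) * F (rowExp l a + ind S) =
      (c * (2 * l - c - 1) / 2 + a) * hookVal F (a + c) c +
        (c * (2 * l - c - 1) / 2 - c) * hookVal F (a + c) (c + 1) := by
  rw [sum_mul_rowExp_add_ind hl hF (Or.inr hc) fun S => ∑ k ∈ S, (rowExp l a k : ℂ)]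
  congr 1
  · by_cases hcl : c ≤ l
    · congr 1
      have hm : (⟨l - 1, by omega⟩ : Fin l) ∈ seg l (l - c) c := by
        rw [mem_seg]; simp only; omega
      have hs : ∀ k : Fin l, ((if (k : ℕ) + 1 = l then a else 0 : ℕ) : ℂ) =
          if k = ⟨l - 1, by omega⟩ then (a : ℂ) else 0 := by
        intro k
        have : (k : ℕ) + 1 = l ↔ k = ⟨l - 1, by omega⟩ := by
          rw [Fin.ext_iff]; simp only; omega
        simp [this]
      simp only [rowExp, Nat.cast_add, sum_add_distrib, hs]
      rw [sum_ite_eq' _ _ (fun _ => (a : ℂ)), if_pos hm, sum_seg (by omega) (fun k => (k : ℂ)),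
        sum_Ico_cast, Nat.cast_sub hcl]
      ring
    · rw [hookVal, if_neg (by omega), mul_zero, mul_zero]
  · by_cases hcl : c + 1 ≤ l
    · have hlast : ∀ k ∈ seg l (l - 1 - c) c, (rowExp l a k : ℂ) = (k : ℕ) := by
        intro k hk
        rw [mem_seg] at hk
        simp only [rowExp]
        rw [if_neg (by omega), add_zero]
      congr 1
      rw [sum_congr rfl hlast, sum_seg (by omega) (fun k => (k : ℂ)), sum_Ico_cast,
        show l - 1 - c = l - (c + 1) by omega, Nat.cast_sub hcl]
      push_cast
      ring
    · rw [hookVal, if_neg (by omega), mul_zero, mul_zero]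

/-- The row indices are consecutive, so only the top `c` rows can be raised without a collision. The
row weight is therefore the constant `(l-c) + ⋯ + (l-1)`. -/
lemma sum_row_weight (hl : 1 ≤ l) (φ : ℕ → ℂ) (n : Fin l → ℕ) {c : ℕ} (hc : 1 ≤ c) :
    ∑ S ∈ powersetCard c univ, (∑ k ∈ S, (rowExp l 0 k : ℂ)) * hankelDet φ (rowExp l 0 + ind S) n =
      c * (2 * l - c - 1) / 2 * ∑ S ∈ powersetCard c univ, hankelDet φ (rowExp l 0) (n + ind S) := by
  have hF : ∀ r : Fin l → ℕ, ¬ Function.Injective r → hankelDet φ r n = 0 :=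
    fun r => hankelDet_eq_zero_of_row
  rw [sum_hankelDet_ind, sum_weight_rowExp_add_ind hl hF hc, sum_rowExp_add_ind hl hF (Or.inr hc)]
  have : hookVal (fun r => hankelDet φ r n) (0 + c) (c + 1) = 0 := by
    rw [hookVal, if_neg (by omega)]
  rw [this]
  push_cast
  ring

variable {φ : ℕ → ℂ} {t α : ℂ}

/-- The relations between the Hankel determinants of hooks of the weights `m`, `m - 1`, `m - 2`
that follow from the three-term recurrence. -/
theorem hookVal_relation (hl : 1 ≤ l)
    (hφ : ∀ k : ℕ, φ k - φ (k + 2) = t * ((k + 1 + α) * φ (k + 1)))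
    {m j : ℕ} (hm : 3 ≤ m) (hj : 1 ≤ j) (hjm : j ≤ m) {D : (Fin l → ℕ) → ℂ}
    (hD : D = hankelDet φ (rowExp l 0)) :
    j * (hookVal D m j + hookVal D m (j + 1)) =
      hookVal (raise D) (m - 1) j + hookVal (raise D) (m - 1) (j - 1) +
      t * ((j - 1) * (2 * l - j + α) * hookVal D (m - 1) j +
        ((j - 1) * (2 * l - j + 1 + α) + m - j) * hookVal D (m - 1) (j - 1)) +
      (j - 2 - l) * (hookVal D (m - 2) (j - 1) + hookVal D (m - 2) (j - 2)) := by
  have hD0 : ∀ n : Fin l → ℕ, ¬ Function.Injective n → D n = 0 := fun n hn => by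
    rw [hD, hankelDet_eq_zero hn]
  have hR0 : ∀ n : Fin l → ℕ, ¬ Function.Injective n → raise D n = 0 := fun n hn => by
    rw [hD, raise_hankelDet_eq_zero hn]
  obtain rfl | ⟨c, rfl⟩ : j = 1 ∨ ∃ c, j = c + 2 := by
    rcases hj.eq_or_lt with h | h
    · exact Or.inl h.symm
    · exact Or.inr ⟨j - 2, by omega⟩
  -- The case `j = 1` has no double raises: `raise` is itself the sum over one-element sets.
  · have h0 : ∀ (F : (Fin l → ℕ) → ℂ) k, hookVal F k 0 = 0 := fun F k => by simp [hookVal]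
    obtain ⟨a, rfl⟩ : ∃ a, m = a + 1 := ⟨m - 1, by omega⟩
    have h1 := sum_rowExp_add_ind hl hD0 (a := a) (c := 1) (Or.inr le_rfl)
    have h2 := sum_rowExp_add_ind hl hR0 (a := a) (c := 0) (Or.inl (by omega))
    have hind : ind (∅ : Finset (Fin l)) = 0 := by ext; simp [ind]
    rw [powersetCard_zero, sum_singleton, hind, add_zero, raise_eq_sum_ind, h1] at h2
    simp only [Nat.add_sub_cancel, Nat.sub_self, Nat.reduceSubDiff, h0, add_zero, zero_add,
      Nat.cast_one, sub_self, zero_mul, mul_zero, one_mul] at h2 ⊢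
    exact h2
  · obtain ⟨a, rfl⟩ : ∃ a, m = a + (c + 2) := ⟨m - (c + 2), by omega⟩
    have hac : 1 ≤ a ∨ 1 ≤ c := by omega
    have h1 := sum_raise_ind D (rowExp l a) c
    have h2 := hankelDet_loop hφ (rowExp l 0) (rowExp l a) c
    simp only [sum_sub_distrib, sum_const, nsmul_eq_mul] at h2
    rw [sum_row_weight hl φ _ (by omega), ← hD, sum_weight_rowExp_add_ind hl hD0 (by omega),
      sum_rowExp_add_ind hl hD0 (Or.inr (by omega))] at h2
    rw [sum_rowExp_add_ind hl hR0 (Or.inr (by omega)),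
      sum_rowExp_add_ind hl hD0 (Or.inr (by omega))] at h1
    -- The unraised terms do not depend on `i`, which ranges over `l - c` columns; this is the
    -- source of the factor `j - 2 - l`.
    have h3 : ∑ S ∈ powersetCard c (univ : Finset (Fin l)),
        ((Sᶜ).card : ℂ) * D (rowExp l a + ind S) =
        (l - c) * (hookVal D (a + c) c + hookVal D (a + c) (c + 1)) := by
      rw [← sum_rowExp_add_ind hl hD0 hac, mul_sum]
      refine sum_congr rfl fun S hS => ?_
      rw [mem_powersetCard_univ] at hS
      have hcl : c ≤ l := by simpa [hS] using S.card_le_univ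
      rw [card_compl, hS, Fintype.card_fin, Nat.cast_sub hcl]
    rw [h3] at h2
    rw [show a + (c + 2) - 1 = a + (c + 1) by omega, show a + (c + 2) - 2 = a + c by omega,
      show c + 2 - 1 = c + 1 by omega, show c + 2 - 2 = c by omega]
    push_cast at h1 h2 ⊢
    linear_combination (-1) * h1 + h2

end Hooks

/-! ### The functions `tau` at hooks and their derivatives -/

section Determinants

lemma colLen_hook {m j : ℕ} (hj : 1 ≤ j) : (hook m j).colLen 0 = j := by
  rw [← YoungDiagram.length_rowLens, hook, YoungDiagram.rowLens_length_ofRowLens]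
  · simp; omega
  · intro x hx
    rcases List.mem_cons.1 hx with rfl | hx
    · omega
    · rw [List.eq_of_mem_replicate hx]; exact one_pos

lemma rowLen_hook {m j : ℕ} (hj : 1 ≤ j) (i : ℕ) :
    (hook m j).rowLen i = if i = 0 then m - j + 1 else if i < j then 1 else 0 := by
  by_cases hi : i < j
  · have h : i < ((m - j + 1) :: List.replicate (j - 1) 1).length := by simp; omega
    rw [hook, YoungDiagram.rowLen_ofRowLens ⟨i, h⟩, if_pos hi]
    rcases i with _ | i <;> simp
  · rw [if_neg (by omega), if_neg hi]
    by_contra h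
    have := YoungDiagram.mem_iff_lt_rowLen.2 (Nat.pos_of_ne_zero h)
    rw [YoungDiagram.mem_iff_lt_colLen, colLen_hook hj] at this
    exact hi this

/-- The sequence `I_{k + α}(2√x)`. -/
noncomputable def besselSeq (α : ℝ) (x : ℂ) (k : ℕ) : ℂ :=
  besselI ((k + α : ℝ) : ℂ) (2 * Complex.sqrt x)

lemma tau_hook {l m j : ℕ} (hj : 1 ≤ j) (hjm : j ≤ m) (α : ℝ) (x : ℂ) :
    tau l (hook m j) α x = hookVal (hankelDet (besselSeq α x) (rowExp l 0)) m j := by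
  rw [tau, colLen_hook hj, hookVal]
  by_cases hjl : j ≤ l
  · rw [if_pos hjl, if_pos ⟨hj, hjm, hjl⟩, hankelDet]
    congr 2
    ext i k
    have hk := k.2
    have he : hookExp l m j k = k + (hook m j).rowLen (Fin.rev k : Fin l) := by
      rw [rowLen_hook hj, hookExp, Fin.val_rev]
      congr 1
      split_ifs <;> omega
    rw [he, besselSeq]
    congr 1
    simp only [rowExp, ite_self]
    push_cast
    ring
  · rw [if_neg hjl, if_neg (by omega)]

lemma besselSeq_recurrence {α : ℝ} (hα : 0 ≤ α) {x : ℂ} (hx : x ∈ Complex.slitPlane) (k : ℕ) :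
    besselSeq α x k - besselSeq α x (k + 2) =
      (1 / Complex.sqrt x) * ((k + 1 + α) * besselSeq α x (k + 1)) := by
  have h := besselI_recurrence (ν := k + α) (by positivity) hx
  unfold besselSeq
  rw [show ((k + 2 : ℕ) : ℝ) + α = k + α + 2 by push_cast; ring,
    show ((k + 1 : ℕ) : ℝ) + α = k + α + 1 by push_cast; ring, h]
  push_cast
  ring

lemma hasDerivAt_besselSeq {α : ℝ} (hα : 0 ≤ α) {x : ℂ} (hx : x ∈ Complex.slitPlane) (k : ℕ) :
    HasDerivAt (fun y => besselSeq α y k)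
      ((1 / Complex.sqrt x) * besselSeq α x (k + 1) + (k + α) / (2 * x) * besselSeq α x k) x := by
  have h := hasDerivAt_besselI_two_mul_sqrt (ν := k + α) (by positivity) hx
  unfold besselSeq
  rw [show ((k + 1 : ℕ) : ℝ) + α = k + α + 1 by push_cast; ring]
  convert! h using 1
  push_cast
  ring

/-- The index-dependent parts of the derivative add up, in every Leibniz term, to the same total of
row and column indices, so they factor out as a scalar. -/
lemma hasDerivAt_hankelDet {l : ℕ} {φ : ℂ → ℕ → ℂ} {t u α x : ℂ}
    (hφ : ∀ k : ℕ, HasDerivAt (fun y => φ y k) (t * φ x (k + 1) + (k + α) / u * φ x k) x)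
    (r n : Fin l → ℕ) :
    HasDerivAt (fun y => hankelDet (φ y) r n)
      (t * raise (hankelDet (φ x) r) n +
        (∑ k, (r k : ℂ) + ∑ k, (n k : ℂ) + l * α) / u * hankelDet (φ x) r n) x := by
  simp only [raise, hankelDet_eq_sum]
  have h : ∀ σ : Equiv.Perm (Fin l), HasDerivAt
      (fun y => (Equiv.Perm.sign σ : ℂ) * ∏ k, φ y (r (σ k) + n k)) _ x := fun σ =>
    (HasDerivAt.fun_finsetProd (u := univ)
      (f := fun k y => φ y (r (σ k) + n k)) fun k _ => hφ (r (σ k) + n k)).const_mul _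
  convert! HasDerivAt.fun_sum (u := univ) fun σ _ => h σ using 1
  rw [sum_comm, mul_sum, mul_sum, ← sum_add_distrib]
  refine sum_congr rfl fun σ _ => ?_
  rw [← mul_sum, mul_left_comm, mul_left_comm _ (Equiv.Perm.sign σ : ℂ), ← mul_add]
  congr 1
  have h1 : ∀ i, ∏ k, φ x (r (σ k) + (n + bump i 1) k) =
      φ x (r (σ i) + n i + 1) * ∏ k ∈ univ.erase i, φ x (r (σ k) + n k) := by
    intro i
    rw [← mul_prod_erase univ _ (mem_univ i)]
    congr 1
    · simp [bump, add_assoc]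
    · refine prod_congr rfl fun k hk => ?_
      simp [bump, (mem_erase.1 hk).1]
  have h2 : ∑ k, (r k : ℂ) = ∑ k, (r (σ k) : ℂ) :=
    (Equiv.sum_comp σ fun k => (r k : ℂ)).symm
  have h3 : (l : ℂ) * α = ∑ _k : Fin l, α := by simp
  rw [h2, h3, ← sum_add_distrib, ← sum_add_distrib, sum_div, sum_mul, mul_sum, ← sum_add_distrib]
  refine sum_congr rfl fun i _ => ?_
  rw [h1, ← mul_prod_erase univ (fun k => φ x (r (σ k) + n k)) (mem_univ i), smul_eq_mul]
  push_cast
  ring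

lemma sum_rowExp {l : ℕ} (hl : 1 ≤ l) (a : ℕ) :
    ∑ k, (rowExp l a k : ℂ) = l * (l - 1) / 2 + a := by
  have h0 : ∑ k : Fin l, ((k : ℕ) : ℂ) = l * (l - 1) / 2 := by
    rw [Fin.sum_univ_eq_sum_range (fun k => (k : ℂ)), range_eq_Ico]
    have := sum_Ico_cast 0 l
    rw [zero_add] at this
    rw [this]
    simp
  have hs : ∀ k : Fin l, ((if (k : ℕ) + 1 = l then a else 0 : ℕ) : ℂ) =
      if k = ⟨l - 1, by omega⟩ then (a : ℂ) else 0 := by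
    intro k
    have : (k : ℕ) + 1 = l ↔ k = ⟨l - 1, by omega⟩ := by
      rw [Fin.ext_iff]; simp only; omega
    simp [this]
  simp only [rowExp, Nat.cast_add, sum_add_distrib, hs, h0, sum_ite_eq', mem_univ, if_true]

lemma sum_hookExp {l m j : ℕ} (hj : 1 ≤ j) (hjm : j ≤ m) (hjl : j ≤ l) :
    ∑ k, (hookExp l m j k : ℂ) = l * (l - 1) / 2 + m := by
  have h := rowExp_add_ind_seg_top (l := l) (a := m - j) hj hjl
  rw [Nat.sub_add_cancel hjm] at h
  have hc : ∑ k, (ind (seg l (l - j) j) k : ℂ) = j := by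
    simp [ind, card_seg (show l - j + j ≤ l by omega)]
  simp only [← h, Pi.add_apply, Nat.cast_add, sum_add_distrib, hc]
  rw [sum_rowExp (hj.trans hjl), Nat.cast_sub hjm]
  ring

lemma hasDerivAt_tau_hook {l m j : ℕ} (hj : 1 ≤ j) (hjm : j ≤ m) {α : ℝ} (hα : 0 ≤ α) {x : ℂ}
    (hx : x ∈ Complex.slitPlane) :
    HasDerivAt (tau l (hook m j) α)
      ((1 / Complex.sqrt x) * hookVal (raise (hankelDet (besselSeq α x) (rowExp l 0))) m j +
        ((l : ℂ) ^ 2 + l * (α - 1) + m) / (2 * x) *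
          hookVal (hankelDet (besselSeq α x) (rowExp l 0)) m j) x := by
  have heq : tau l (hook m j) α =
      fun y => hookVal (hankelDet (besselSeq α y) (rowExp l 0)) m j :=
    funext fun y => tau_hook hj hjm α y
  rw [heq]
  unfold hookVal
  by_cases hjl : j ≤ l
  · simp only [if_pos (show 1 ≤ j ∧ j ≤ m ∧ j ≤ l from ⟨hj, hjm, hjl⟩)]
    have h := hasDerivAt_hankelDet (hasDerivAt_besselSeq hα hx) (rowExp l 0) (hookExp l m j)
    rw [sum_rowExp (hj.trans hjl), sum_hookExp hj hjm hjl] at h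
    convert! h using 3
    push_cast
    ring
  · simp only [if_neg (show ¬(1 ≤ j ∧ j ≤ m ∧ j ≤ l) by omega)]
    simpa using hasDerivAt_const x (0 : ℂ)

end Determinants

/-! ### Solving the bidiagonal system -/

section Coefficients

lemma sum_two_terms {f : ℕ → ℂ} (hf : f 0 = 0) {N j : ℕ} (hj : j ≤ N) (a b : ℂ) :
    ∑ k ∈ range N, (if k + 1 = j then a else if k + 1 + 1 = j then b else 0) * f (k + 1) =
      a * f j + b * f (j - 1) := by
  have h : ∀ k, (if k + 1 = j then a else if k + 1 + 1 = j then b else 0) * f (k + 1) =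
      (if k + 1 = j then a * f j else 0) + if k + 1 + 1 = j then b * f (j - 1) else 0 := by
    intro k
    split_ifs with h1 h2 h2
    · omega
    · subst h1; simp
    · subst h2; simp
    · simp
  simp only [h, sum_add_distrib]
  congr 1
  · rcases j with _ | j
    · simp [hf]
    · simp only [Nat.add_right_cancel_iff, sum_ite_eq', mem_range]
      rw [if_pos (by omega)]
  · rcases j with _ | _ | j
    · simp [hf]
    · simp [hf]
    · simp only [Nat.add_right_cancel_iff, sum_ite_eq', mem_range]
      rw [if_pos (by omega)]

/-- Adding consecutive rows cancels the alternating tail and leaves two entries, the coefficients of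
the relation divided by `j`. The same holds for `c1Entry` and `c2Entry` below. -/
lemma bEntry_add_bEntry_succ {m j k : ℕ} (hj : 1 ≤ j) (hk : 1 ≤ k) (hkm : k < m) :
    bEntry m j k + bEntry m (j + 1) k =
      if k = j then -1 / (j : ℂ) else if k + 1 = j then -1 / (j : ℂ) else 0 := by
  have hk0 : (k : ℂ) ≠ 0 := by exact_mod_cast (by omega : k ≠ 0)
  have hk1 : (k + 1 : ℂ) ≠ 0 := by exact_mod_cast (by omega : k + 1 ≠ 0)
  unfold bEntry
  rw [if_neg hkm.ne, if_neg hkm.ne]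
  rcases lt_trichotomy k j with h | rfl | h
  · rw [if_neg (by omega), if_neg (by omega : ¬ j + 1 ≤ k), if_neg (by omega : ¬ k + 1 = j + 1),
      if_neg h.ne]
    simp
  · rw [if_pos le_rfl, if_neg (by omega), if_pos rfl, if_pos rfl,
      Odd.neg_one_pow ⟨k - 1, by omega⟩]
    push_cast
    field_simp
    ring
  · rw [if_pos h.le, if_pos (by omega : j + 1 ≤ k), if_neg h.ne', if_neg (by omega),
      show j + 1 + k - 1 = j + k - 1 + 1 by omega, pow_succ]
    ring

lemma c1Entry_add_c1Entry_succ (l m : ℕ) (α : ℝ) {j k : ℕ} (hj : 1 ≤ j) (hk : 1 ≤ k) :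
    c1Entry l m α j k + c1Entry l m α (j + 1) k =
      if k = j then -((j - 1) * (2 * l - j + α)) / (j : ℂ)
      else if k + 1 = j then -((j - 1) * (2 * l - j + 1 + α) + m - j) / (j : ℂ) else 0 := by
  have hk0 : (k : ℂ) ≠ 0 := by exact_mod_cast (by omega : k ≠ 0)
  have hk1 : (k + 1 : ℂ) ≠ 0 := by exact_mod_cast (by omega : k + 1 ≠ 0)
  unfold c1Entry
  rcases lt_trichotomy k j with h | rfl | h
  · rw [if_neg (by omega), if_neg (by omega : ¬ j + 1 ≤ k), if_neg (by omega : ¬ k + 1 = j + 1),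
      if_neg h.ne]
    split_ifs with h1
    · subst h1
      push_cast
      field_simp
      ring
    · simp
  · rw [if_pos le_rfl, if_neg (by omega), if_pos rfl, if_pos rfl, Even.neg_one_pow ⟨k, rfl⟩]
    field_simp
    ring
  · rw [if_pos h.le, if_pos (by omega : j + 1 ≤ k), if_neg h.ne', if_neg (by omega),
      show j + 1 + k = j + k + 1 by omega, pow_succ]
    ring

lemma c2Entry_add_c2Entry_succ (l : ℕ) {j k : ℕ} (hk : 1 ≤ k) :
    c2Entry l j k + c2Entry l (j + 1) k =
      if k = j - 1 then (j - 2 - l) / (j : ℂ)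
      else if k + 1 = j - 1 then (j - 2 - l) / (j : ℂ) else 0 := by
  have hk1 : (k + 1 : ℂ) ≠ 0 := by exact_mod_cast (by omega : k + 1 ≠ 0)
  have hk2 : (k + 2 : ℂ) ≠ 0 := by exact_mod_cast (by omega : k + 2 ≠ 0)
  have hk11 : (k + 1 + 1 : ℂ) ≠ 0 := by exact_mod_cast (by omega : k + 1 + 1 ≠ 0)
  unfold c2Entry
  rcases lt_trichotomy (k + 1) j with h | rfl | h
  · rw [if_neg (by omega), if_neg (by omega : ¬ j + 1 ≤ k + 1),
      if_neg (by omega : ¬ k + 2 = j + 1), if_neg (by omega : ¬ k = j - 1)]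
    by_cases h1 : k + 2 = j
    · rw [if_pos h1, if_pos (by omega)]
      ring
    · rw [if_neg h1, if_neg (by omega)]
      simp
  · rw [if_pos le_rfl, if_neg (by omega), if_pos rfl, if_pos (by omega),
      Odd.neg_one_pow ⟨k, by omega⟩]
    push_cast
    field_simp
    ring
  · rw [if_pos h.le, if_pos (by omega), if_neg (by omega), if_neg (by omega),
      show j + 1 + k = j + k + 1 by omega, pow_succ]
    ring

/-- Solving the relations between consecutive entries of `H` from the last entry upwards. -/
lemma eq_sum_of_relation {l m : ℕ} {α : ℝ} (hm : 3 ≤ m) {t : ℂ} {H L T U : ℕ → ℂ}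
    (hH : H (m + 1) = 0) (hL0 : L 0 = 0) (hLm : L m = 0) (hT0 : T 0 = 0) (hTm : T m = 0)
    (hU0 : U 0 = 0) (hUm : U (m - 1) = 0)
    (hrel : ∀ j : ℕ, 1 ≤ j → j ≤ m → j * (H j + H (j + 1)) = L j + L (j - 1) +
      t * ((j - 1) * (2 * l - j + α) * T j + ((j - 1) * (2 * l - j + 1 + α) + m - j) * T (j - 1)) +
      (j - 2 - l) * (U (j - 1) + U (j - 2)))
    {j : ℕ} (hj : 1 ≤ j) (hjm : j ≤ m) :
    H j = -∑ k ∈ range (m - 1), bEntry m j (k + 1) * L (k + 1) -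
      t * ∑ k ∈ range (m - 1), c1Entry l m α j (k + 1) * T (k + 1) +
      ∑ k ∈ range (m - 2), c2Entry l j (k + 1) * U (k + 1) := by
  induction hd : m - j generalizing j with
  -- In the last row each matrix has only its last relevant entry, and the relation for `j = m`
  -- determines `H m` because `H (m + 1) = 0`.
  | zero =>
    obtain rfl : j = m := by omega
    clear hjm hd
    have hj0 : (j : ℂ) ≠ 0 := by exact_mod_cast (by omega : j ≠ 0)
    obtain ⟨n, rfl⟩ : ∃ n, j = n + 3 := ⟨j - 3, by omega⟩
    have hr := hrel (n + 3) hj le_rfl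
    have h1 : ∑ k ∈ range (n + 3 - 1), bEntry (n + 3) (n + 3) (k + 1) * L (k + 1) =
        -1 / (n + 3 : ℕ) * L (n + 2) := by
      rw [show n + 3 - 1 = n + 1 + 1 by omega, sum_range_succ, sum_eq_zero, zero_add]
      · congr 1
        simp [bEntry]
      · intro k hk
        rw [mem_range] at hk
        rw [bEntry, if_neg (by omega), if_neg (by omega), if_neg (by omega), zero_mul]
    have h2 : ∑ k ∈ range (n + 3 - 1), c1Entry l (n + 3) α (n + 3) (k + 1) * T (k + 1) =
        -(1 / (n + 3 : ℕ)) * ((n + 2) * (2 * l - (n + 2) + α)) * T (n + 2) := by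
      rw [show n + 3 - 1 = n + 1 + 1 by omega, sum_range_succ, sum_eq_zero, zero_add]
      · congr 1
        rw [c1Entry, if_neg (by omega), if_pos rfl]
        push_cast
        ring
      · intro k hk
        rw [mem_range] at hk
        rw [c1Entry, if_neg (by omega), if_neg (by omega), zero_mul]
    have h3 : ∑ k ∈ range (n + 3 - 2), c2Entry l (n + 3) (k + 1) * U (k + 1) =
        ((n + 3 : ℕ) - l - 2) / (n + 3 : ℕ) * U (n + 1) := by
      rw [show n + 3 - 2 = n + 1 by omega, sum_range_succ, sum_eq_zero, zero_add]
      · congr 1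
        rw [c2Entry, if_neg (by omega), if_pos rfl]
      · intro k hk
        rw [mem_range] at hk
        rw [c2Entry, if_neg (by omega), if_neg (by omega), zero_mul]
    rw [h1, h2, h3]
    rw [hH, hLm, hTm, hUm, show n + 3 - 1 = n + 2 by omega, show n + 3 - 2 = n + 1 by omega] at hr
    field_simp
    push_cast at hr ⊢
    linear_combination hr
  | succ d ih =>
    have hj0 : (j : ℂ) ≠ 0 := by exact_mod_cast (by omega : j ≠ 0)
    have hr := hrel j hj hjm
    have h1 : ∑ k ∈ range (m - 1), bEntry m j (k + 1) * L (k + 1) +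
        ∑ k ∈ range (m - 1), bEntry m (j + 1) (k + 1) * L (k + 1) =
        -1 / (j : ℂ) * L j + -1 / (j : ℂ) * L (j - 1) := by
      rw [← sum_two_terms hL0 (by omega : j ≤ m - 1), ← sum_add_distrib]
      refine sum_congr rfl fun k hk => ?_
      rw [mem_range] at hk
      rw [← add_mul, bEntry_add_bEntry_succ hj (by omega) (by omega)]
    have h2 := sum_two_terms hT0 (by omega : j ≤ m - 1) (-((j - 1) * (2 * l - j + α)) / (j : ℂ))
      (-((j - 1) * (2 * l - j + 1 + α) + m - j) / (j : ℂ))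
    have h3 := sum_two_terms hU0 (by omega : j - 1 ≤ m - 2) ((j - 2 - l) / (j : ℂ))
      ((j - 2 - l) / (j : ℂ))
    simp only [← c1Entry_add_c1Entry_succ l m α hj (Nat.le_add_left 1 _), add_mul,
      sum_add_distrib] at h2
    simp only [← c2Entry_add_c2Entry_succ l (Nat.le_add_left 1 _), add_mul, sum_add_distrib] at h3
    have ih' := ih (j := j + 1) (by omega) (by omega) (by omega)
    have hr' : H j + H (j + 1) = (1 / (j : ℂ)) * (L j + L (j - 1) +
      t * ((j - 1) * (2 * l - j + α) * T j + ((j - 1) * (2 * l - j + 1 + α) + m - j) * T (j - 1)) +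
      (j - 2 - l) * (U (j - 1) + U (j - 2))) := by
      rw [← hr]
      field_simp
    rw [show j - 1 - 1 = j - 2 by omega] at h3
    linear_combination hr' - ih' + h1 + t * h2 - h3

end Coefficients

end BesselHankel

/-! ### The matrix identity -/

theorem mainTheorem4 (l m : ℕ) (hl : 1 ≤ l) (hm : 3 ≤ m) (α : ℝ) (hα : 0 ≤ α)
    (x : ℂ) (hx : x ∈ Complex.slitPlane) :
    (∀ k : ℕ, 1 ≤ k → k ≤ m - 1 →
      DifferentiableAt ℂ (BesselHankel.tau l (BesselHankel.hook (m - 1) k) α) x) ∧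
    tauVec l m α x =
      -(Complex.sqrt x • (matB m *ᵥ appendZero m (derivTauVec l (m - 1) α x)))
      + (((l : ℂ) ^ 2 + l * (α - 1) + m - 1) / (2 * Complex.sqrt x)) •
          (matB m *ᵥ appendZero m (tauVec l (m - 1) α x))
      - (1 / Complex.sqrt x) • (matC1 l m α *ᵥ tauVec l (m - 1) α x)
      + matC2 l m *ᵥ tauVec l (m - 2) α x := by
  refine ⟨fun k hk hkm => (hasDerivAt_tau_hook hk hkm hα hx).differentiableAt, ?_⟩
  have hs := sqrt_ne_zero hx
  have hx0 := Complex.slitPlane_ne_zero hx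
  set s := Complex.sqrt x
  have hss : s * s = x := sqrt_mul_self x
  set D := hankelDet (besselSeq α x) (rowExp l 0) with hD
  have hout : ∀ (F : (Fin l → ℕ) → ℂ) (p q : ℕ), p < q → hookVal F p q = 0 := fun F p q h => by
    rw [hookVal, if_neg (by omega)]
  have hzero : ∀ (F : (Fin l → ℕ) → ℂ) (p : ℕ), hookVal F p 0 = 0 := fun F p => by
    simp [hookVal]
  -- The column `k = m` of `matB` meets only the appended zero and drops out.
  have hB : ∀ (f : ℕ → ℂ) (v : Fin (m - 1) → ℂ), (∀ i : Fin (m - 1), v i = f (i + 1)) →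
      ∀ i : Fin m, (matB m *ᵥ appendZero m v) i =
        ∑ k ∈ Finset.range (m - 1), bEntry m (i + 1) (k + 1) * f (k + 1) := by
    intro f v hv i
    let g : ℕ → ℂ := fun k => bEntry m (i + 1) (k + 1) * if k < m - 1 then f (k + 1) else 0
    have h1 : (matB m *ᵥ appendZero m v) i = ∑ k : Fin m, g k := by
      simp only [Matrix.mulVec, dotProduct]
      refine Finset.sum_congr rfl fun k _ => ?_
      simp only [g, matB, Matrix.of_apply, appendZero]
      split_ifs with h
      · rw [hv]
      · rfl
    rw [h1, Fin.sum_univ_eq_sum_range g, show Finset.range m = Finset.range (m - 1 + 1) by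
      rw [Nat.sub_add_cancel (by omega)], Finset.sum_range_succ]
    simp only [g, lt_irrefl, if_false, mul_zero, add_zero]
    refine Finset.sum_congr rfl fun k hk => ?_
    rw [if_pos (Finset.mem_range.1 hk)]
  have hT : ∀ p : ℕ, ∀ i : Fin p, tauVec l p α x i = hookVal D p (i + 1) := fun p i =>
    tau_hook (by omega) (by omega) α x
  have hm1 : ((m - 1 : ℕ) : ℂ) = m - 1 := by rw [Nat.cast_sub (by omega)]; simp
  let dT : ℕ → ℂ := fun j => (1 / s) * hookVal (raise D) (m - 1) j +
    ((l : ℂ) ^ 2 + l * (α - 1) + m - 1) / (2 * x) * hookVal D (m - 1) j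
  have hdT : ∀ i : Fin (m - 1), derivTauVec l (m - 1) α x i = dT (i + 1) := fun i => by
    have := (hasDerivAt_tau_hook (l := l) (m := m - 1) (j := i + 1) (by omega) (by omega)
      hα hx).deriv
    rw [hm1, ← add_sub_assoc] at this
    exact this
  have hC1 : ∀ i : Fin m, (matC1 l m α *ᵥ tauVec l (m - 1) α x) i =
      ∑ k ∈ Finset.range (m - 1), c1Entry l m α (i + 1) (k + 1) * hookVal D (m - 1) (k + 1) := by
    intro i
    rw [← Fin.sum_univ_eq_sum_range fun k =>
      c1Entry l m α (i + 1) (k + 1) * hookVal D (m - 1) (k + 1)]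
    simp only [Matrix.mulVec, dotProduct, hT]
    rfl
  have hC2 : ∀ i : Fin m, (matC2 l m *ᵥ tauVec l (m - 2) α x) i =
      ∑ k ∈ Finset.range (m - 2), c2Entry l (i + 1) (k + 1) * hookVal D (m - 2) (k + 1) := by
    intro i
    rw [← Fin.sum_univ_eq_sum_range fun k =>
      c2Entry l (i + 1) (k + 1) * hookVal D (m - 2) (k + 1)]
    simp only [Matrix.mulVec, dotProduct, hT]
    rfl
  ext i
  have key := eq_sum_of_relation (l := l) (α := α) hm (hout D m (m + 1) (by omega))
    (hzero (raise D) (m - 1)) (hout _ _ _ (by omega)) (hzero D (m - 1)) (hout _ _ _ (by omega))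
    (hzero D (m - 2)) (hout _ _ _ (by omega))
    (fun j hj hjm => hookVal_relation hl (besselSeq_recurrence hα hx) hm hj hjm hD)
    (by omega : 1 ≤ (i : ℕ) + 1) (by omega)
  simp only [Pi.add_apply, Pi.sub_apply, Pi.neg_apply, Pi.smul_apply, smul_eq_mul]
  rw [hB dT _ hdT, hB (hookVal D (m - 1)) _ (hT (m - 1)), hC1, hC2, hT, key]
  congr 2
  -- Since `x = s * s`, multiplying the derivative by `s` turns its scalar part into the coefficient
  -- of the second matrix term. The two cancel, leaving only the `raise` values.
  rw [Finset.mul_sum, Finset.mul_sum, ← Finset.sum_neg_distrib, ← Finset.sum_neg_distrib,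
    ← Finset.sum_add_distrib]
  refine Finset.sum_congr rfl fun k _ => ?_
  simp only [dT]
  rw [← hss]
  field_simp
  ring
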